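/- Fix a countable supply of atomic propositions (the natural numbers) and two trace variables $x_1,x_2$. A trace is an infinite word $\pi$ over sets of atomic propositions. Quantifier-free HyperLTL formulas are given by $\psi ::= \top \mid p[x] \mid \neg\psi \mid \psi\wedge\psi \mid \mathsf{X}\psi \mid \psi\,\mathsf{U}\,\psi$, with $p$ an atomic proposition and $x\in\{x_1,x_2\}$; quantifier-free HyperLTL$_C$ formulas have in addition the context modalities $\{C\}\psi$ for non-empty sets $C$ of trace variables; $\mathsf{F}\psi$ abbreviates $\top\,\mathsf{U}\,\psi$. For an assignment $\Pi$ of pointed traces $(\pi,i)$ to variables and a context $C$, let $\Pi+_C i$ advance the positions of the variables in $C$ by $i$ and leave the others unchanged; then $(\Pi,C)\models p[x]$ iff $\Pi(x)=(\pi,i)$ with $p\in\pi(i)$; $(\Pi,C)\models\mathsf{X}\psi$ iff $(\Pi+_C1,C)\models\psi$; $(\Pi,C)\models\psi_1\mathsf{U}\psi_2$ iff for some $i\ge 0$, $(\Pi+_Ci,C)\models\psi_2$ and $(\Pi+_Ck,C)\models\psi_1$ for all $k<i$; $(\Pi,C)\models\{C'\}\psi$ iff $(\Pi,C')\models\psi$;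 Boolean connectives are as usual. Trace quantifiers range over a given set $\mathcal{L}$ of traces and bind a variable to $(\pi,0)$ with $\pi\in\mathcal{L}$; the quantifier-free part is evaluated in the context of all variables. The fragment $\mathcal{U}$ of HyperLTL$_C$ consists of the sentences $\exists x_1.\exists x_2.\ \psi_0\wedge\{x_2\}\mathsf{F}\{x_1,x_2\}\psi$ with $\psi_0,\psi$ quantifier-free HyperLTL formulas. The model-checking problem against $\mathcal{U}$ is: given a finite Kripke structure $\mathcal{K}$ (finitely many states, each labelled with a finite set of atomic propositions; initial states; a transition relation, not necessarily total) and a sentence $\varphi\in\mathcal{U}$, decide whether $\mathcal{L}(\mathcal{K})\models\varphi$, where $\mathcal{L}(\mathcal{K})$ is the set of traces of the infinite paths of $\mathcal{K}$ starting in an initial state. **Theorem.** Model checking against the fragment $\mathcal{U}$ of HyperLTL$_C$ is $\Sigma^0_1$-hard: every recursively enumerable predicate is many-one reducible (by a computable function) to it. -/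

import Mathlib

namespace HyperMC

/-! ### Traces, Kripke structures and pointed-trace assignments -/

/-- A trace over `AP` is an infinite word over `2^AP`. -/
abbrev Trace (AP : Type*) := ℕ → Set AP

/-- A Kripke structure over `AP`: finitely many states, a set of initial states, a transition
relation (not required to be total) and a valuation of the states. -/
structure Kripke (AP : Type*) where
  State : Type
  finite_state : Finite State
  init : Set State
  edge : State → State → Prop
  val : State → Set AP

/-- `t` is a path of `K`: an infinite sequence of states that starts in an initial state and follows
the transition relation. -/
def Kripke.IsPath {AP : Type*} (K : Kripke AP) (t : ℕ → K.State) : Prop :=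
  t 0 ∈ K.init ∧ ∀ i, K.edge (t i) (t (i + 1))

/-- The set of traces induced by a Kripke structure. -/
def Kripke.traces {AP : Type*} (K : Kripke AP) : Set (Trace AP) :=
  {π | ∃ t : ℕ → K.State, K.IsPath t ∧ ∀ i, π i = K.val (t i)}

/-- A pointed-trace assignment: a partial map from trace variables to pointed traces. -/
abbrev PAssign (AP Var : Type*) := Var → Option (Trace AP × ℕ)

open Classical in
/-- `Π +_C i`: the positions of the variables in `C` advance by `i`, the others do not move. -/
noncomputable def PAssign.shift {AP Var : Type*} (P : PAssign AP Var) (C : Set Var) (i : ℕ) :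
    PAssign AP Var :=
  fun x => if x ∈ C then (P x).map (fun q => (q.1, q.2 + i)) else P x

open Classical in
/-- `Π[x ↦ (π, 0)]`. -/
noncomputable def PAssign.bind {AP Var : Type*} (P : PAssign AP Var) (x : Var) (π : Trace AP) :
    PAssign AP Var :=
  fun y => if y = x then some (π, 0) else P y

/-! ### Context HyperLTL -/

/-- Quantifier-free formulas of context HyperLTL. The modality `ctx C ψ`, for a non-empty set `C` of
trace variables, is written `⟨C⟩ψ` or `{x₁, …, xₖ}ψ`. -/
inductive QFC (AP Var : Type*) where
  | top : QFC AP Var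
  | atom (p : AP) (x : Var) : QFC AP Var
  | neg (ψ : QFC AP Var) : QFC AP Var
  | and (ψ₁ ψ₂ : QFC AP Var) : QFC AP Var
  | next (ψ : QFC AP Var) : QFC AP Var
  | untl (ψ₁ ψ₂ : QFC AP Var) : QFC AP Var
  | ctx (C : Set Var) (hC : C.Nonempty) (ψ : QFC AP Var) : QFC AP Var

/-- The eventually modality `F ψ = ⊤ U ψ`. -/
def QFC.eventually {AP Var : Type*} (ψ : QFC AP Var) : QFC AP Var := .untl .top ψ

/-- The satisfaction relation `(Π, C) ⊨ ψ`. -/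
def QFC.Sat {AP Var : Type*} : QFC AP Var → PAssign AP Var → Set Var → Prop
  | .top, _, _ => True
  | .atom p x, P, _ => ∃ π i, P x = some (π, i) ∧ p ∈ π i
  | .neg ψ, P, C => ¬ ψ.Sat P C
  | .and ψ₁ ψ₂, P, C => ψ₁.Sat P C ∧ ψ₂.Sat P C
  | .next ψ, P, C => ψ.Sat (P.shift C 1) C
  | .untl ψ₁ ψ₂, P, C =>
      ∃ i, ψ₂.Sat (P.shift C i) C ∧ ∀ k < i, ψ₁.Sat (P.shift C k) C
  | .ctx C' _ ψ, P, _ => ψ.Sat P C'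

/-- Context HyperLTL formulas: a prefix of trace quantifiers in front of a quantifier-free
formula. -/
inductive Expr (AP Var : Type*) where
  | ex (x : Var) (ξ : Expr AP Var) : Expr AP Var
  | all (x : Var) (ξ : Expr AP Var) : Expr AP Var
  | qf (ψ : QFC AP Var) : Expr AP Var

/-- The satisfaction relation `(L, Π) ⊨ ξ`. The initial context is the set of all variables. -/
def Expr.Sat {AP Var : Type*} (L : Set (Trace AP)) : Expr AP Var → PAssign AP Var → Prop
  | .ex x ξ, P => ∃ π ∈ L, ξ.Sat L (P.bind x π)
  | .all x ξ, P => ∀ π ∈ L, ξ.Sat L (P.bind x π)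
  | .qf ψ, P => ψ.Sat P Set.univ

/-- `L ⊨ ξ` for a sentence `ξ`: satisfaction under the empty assignment. -/
def Expr.Models {AP Var : Type*} (L : Set (Trace AP)) (ξ : Expr AP Var) : Prop :=
  ξ.Sat L (fun _ => none)

/-! ### Quantifier-free HyperLTL and the fragment `U` -/

/-- Quantifier-free HyperLTL formulas, i.e. LTL formulas with relativized atoms `p[x]`. -/
inductive QF (AP Var : Type*) where
  | top : QF AP Var
  | atom (p : AP) (x : Var) : QF AP Var
  | neg (ψ : QF AP Var) : QF AP Var
  | and (ψ₁ ψ₂ : QF AP Var) : QF AP Var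
  | next (ψ : QF AP Var) : QF AP Var
  | untl (ψ₁ ψ₂ : QF AP Var) : QF AP Var

/-- Quantifier-free HyperLTL formulas are quantifier-free context HyperLTL formulas in which no
context modality occurs. -/
def QF.toQFC {AP Var : Type*} : QF AP Var → QFC AP Var
  | .top => .top
  | .atom p x => .atom p x
  | .neg ψ => .neg ψ.toQFC
  | .and ψ₁ ψ₂ => .and ψ₁.toQFC ψ₂.toQFC
  | .next ψ => .next ψ.toQFC
  | .untl ψ₁ ψ₂ => .untl ψ₁.toQFC ψ₂.toQFC

/-- The formula `∃ x₁. ∃ x₂. ψ₀ ∧ {x₂} F {x₁, x₂} ψ` of the fragment `U`. The two trace variables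
`x₁` and `x₂` are `0` and `1` in `Fin 2`. -/
def uFormula {AP : Type*} (ψ₀ ψ : QF AP (Fin 2)) : Expr AP (Fin 2) :=
  .ex 0 (.ex 1 (.qf (.and ψ₀.toQFC
    (.ctx {1} (Set.singleton_nonempty 1)
      (.eventually (.ctx {0, 1} (Set.insert_nonempty 0 {1}) ψ.toQFC))))))

/-! ### Instances of the model-checking problem as finite objects -/

/-- A finite description of a Kripke structure over atomic propositions named by natural numbers:
the number of states, a list of initial states, a list of transitions, and a list of pairs `(s, p)`
that say that the proposition `p` holds in the state `s`. -/
structure KripkeCode where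
  numStates : ℕ
  initList : List ℕ
  edgeList : List (ℕ × ℕ)
  labelList : List (ℕ × ℕ)

/-- The Kripke structure described by a `KripkeCode`; its states are `0, …, numStates - 1`. -/
def KripkeCode.toKripke (c : KripkeCode) : Kripke ℕ where
  State := Fin c.numStates
  finite_state := inferInstance
  init := {s | s.val ∈ c.initList}
  edge := fun s t => (s.val, t.val) ∈ c.edgeList
  val := fun s => {p | (s.val, p) ∈ c.labelList}

/-- A `KripkeCode` is a tuple of numbers and lists. -/
def KripkeCode.equivProd : KripkeCode ≃ ℕ × List ℕ × List (ℕ × ℕ) × List (ℕ × ℕ) where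
  toFun c := (c.numStates, c.initList, c.edgeList, c.labelList)
  invFun t := ⟨t.1, t.2.1, t.2.2.1, t.2.2.2⟩
  left_inv _ := rfl
  right_inv _ := rfl

instance KripkeCode.instPrimcodable : Primcodable KripkeCode :=
  Primcodable.ofEquiv _ KripkeCode.equivProd

/-- The Gödel number of a two-variable quantifier-free HyperLTL formula. -/
def QF.toNat : QF ℕ (Fin 2) → ℕ
  | .top => 0
  | .atom p x => 5 * (2 * p + x.val) + 1
  | .neg ψ => 5 * ψ.toNat + 2
  | .next ψ => 5 * ψ.toNat + 3
  | .and ψ₁ ψ₂ => 5 * Nat.pair ψ₁.toNat ψ₂.toNat + 4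
  | .untl ψ₁ ψ₂ => 5 * Nat.pair ψ₁.toNat ψ₂.toNat + 5

/-- The formula with a given Gödel number. -/
def QF.ofNat : ℕ → QF ℕ (Fin 2)
  | 0 => .top
  | n + 1 =>
    have h₀ : n / 5 < n + 1 := by omega
    have h₁ : (n / 5).unpair.1 < n + 1 := lt_of_le_of_lt (Nat.unpair_left_le _) h₀
    have h₂ : (n / 5).unpair.2 < n + 1 := lt_of_le_of_lt (Nat.unpair_right_le _) h₀
    match n % 5 with
    | 0 => .atom (n / 5 / 2) ⟨n / 5 % 2, Nat.mod_lt _ (by omega)⟩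
    | 1 => .neg (QF.ofNat (n / 5))
    | 2 => .next (QF.ofNat (n / 5))
    | 3 => .and (QF.ofNat (n / 5).unpair.1) (QF.ofNat (n / 5).unpair.2)
    | _ => .untl (QF.ofNat (n / 5).unpair.1) (QF.ofNat (n / 5).unpair.2)
termination_by n => n

theorem QF.ofNat_toNat (ψ : QF ℕ (Fin 2)) : QF.ofNat ψ.toNat = ψ := by
  induction ψ with
  | top => simp [QF.toNat, QF.ofNat]
  | atom p x =>
    have h1 : 5 * (2 * p + x.val) % 5 = 0 := by omega
    have h2 : 5 * (2 * p + x.val) / 5 = 2 * p + x.val := by omega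
    have h3 : (2 * p + x.val) / 2 = p := by omega
    have h4 : (2 * p + x.val) % 2 = x.val := by omega
    rw [QF.toNat, QF.ofNat]
    simp [h1, h2, h3, h4]
  | neg ψ ih =>
    have h1 : (5 * ψ.toNat + 1) % 5 = 1 := by omega
    have h2 : (5 * ψ.toNat + 1) / 5 = ψ.toNat := by omega
    rw [QF.toNat, QF.ofNat]
    simp [h1, h2, ih]
  | next ψ ih =>
    have h1 : (5 * ψ.toNat + 2) % 5 = 2 := by omega
    have h2 : (5 * ψ.toNat + 2) / 5 = ψ.toNat := by omega
    rw [QF.toNat, QF.ofNat]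
    simp [h1, h2, ih]
  | and ψ₁ ψ₂ ih₁ ih₂ =>
    have h1 : (5 * Nat.pair ψ₁.toNat ψ₂.toNat + 3) % 5 = 3 := by omega
    have h2 : (5 * Nat.pair ψ₁.toNat ψ₂.toNat + 3) / 5 = Nat.pair ψ₁.toNat ψ₂.toNat := by omega
    rw [QF.toNat, QF.ofNat]
    simp [h1, h2, ih₁, ih₂]
  | untl ψ₁ ψ₂ ih₁ ih₂ =>
    have h1 : (5 * Nat.pair ψ₁.toNat ψ₂.toNat + 4) % 5 = 4 := by omega
    have h2 : (5 * Nat.pair ψ₁.toNat ψ₂.toNat + 4) / 5 = Nat.pair ψ₁.toNat ψ₂.toNat := by omega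
    rw [QF.toNat, QF.ofNat]
    simp [h1, h2, ih₁, ih₂]

theorem QF.toNat_ofNat (n : ℕ) : (QF.ofNat n).toNat = n := by
  induction n using Nat.strong_induction_on with
  | _ n ih =>
    cases n with
    | zero => simp [QF.toNat, QF.ofNat]
    | succ n =>
      have h₀ : n / 5 < n + 1 := by omega
      have h₁ : (n / 5).unpair.1 < n + 1 := lt_of_le_of_lt (Nat.unpair_left_le _) h₀
      have h₂ : (n / 5).unpair.2 < n + 1 := lt_of_le_of_lt (Nat.unpair_right_le _) h₀
      rw [QF.ofNat]
      have hlt : n % 5 < 5 := Nat.mod_lt _ (by omega)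
      split
      · simp only [QF.toNat]; omega
      · simp only [QF.toNat, ih _ h₀]; omega
      · simp only [QF.toNat, ih _ h₀]; omega
      · simp only [QF.toNat, ih _ h₁, ih _ h₂, Nat.pair_unpair]; omega
      · simp only [QF.toNat, ih _ h₁, ih _ h₂, Nat.pair_unpair]
        have e₀ : ¬ n % 5 = 0 := by assumption
        have e₁ : ¬ n % 5 = 1 := by assumption
        have e₂ : ¬ n % 5 = 2 := by assumption
        have e₃ : ¬ n % 5 = 3 := by assumption
        omega

instance QF.instDenumerable : Denumerable (QF ℕ (Fin 2)) :=
  Denumerable.mk' ⟨QF.toNat, QF.ofNat, QF.ofNat_toNat, QF.toNat_ofNat⟩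

/-- The model-checking problem against the fragment `U`: an instance consists of a Kripke structure
`K` and of the `U`-formula `∃ x₁. ∃ x₂. ψ₀ ∧ {x₂} F {x₁, x₂} ψ` that is given by the two
quantifier-free HyperLTL formulas `ψ₀` and `ψ`. -/
def UModelChecking (inst : KripkeCode × QF ℕ (Fin 2) × QF ℕ (Fin 2)) : Prop :=
  (uFormula inst.2.1 inst.2.2).Models inst.1.toKripke.traces

end HyperMC

/-! Both quantifiers can be forced to pick the same word `w`, and `{x₂} F` then chooses an arbitrary
offset `n` between its two readings (`uFormula_models_iff`). The remaining formula compares `w`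
locally with itself at distance `n`. Cut into rows of length `n`, the word is thus a two-dimensional
array of unbounded width whose consecutive rows obey a local rule. The marker letter `m` ends the
first row and occurs nowhere else, which makes `n` equal to the row length
(`uModelChecking_iff_spiral`). Such an array holds the space-time diagram of a Turing machine: the
first row is the input padded with a guessed number of blanks, the rule is the transition function,
and some letter must show a halting head. A halting run needs only finitely many cells, so a
suitable width exists exactly when the machine halts (`spiral_iff_eval_dom`). A recursively
enumerable predicate is the halting set of one machine with finitely many states
(`exists_finite_TM0_of_partrec`). The machine fixes the alphabet, the Kripke structure and the rule;
only the part of the formula that spells out the input varies, and it is computed from the instance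
(`spiral_manyOneReducible`). -/

namespace HyperMC

/-! ### Semantics of quantifier-free formulas under total assignments -/

/-- Satisfaction of a quantifier-free formula when every variable `x` is bound to the trace `π x`
and read at the position `i x`. -/
def QF.Holds {AP Var : Type*} (π : Var → Trace AP) : QF AP Var → (Var → ℕ) → Prop
  | .top, _ => True
  | .atom p x, i => p ∈ π x (i x)
  | .neg ψ, i => ¬ ψ.Holds π i
  | .and ψ₁ ψ₂, i => ψ₁.Holds π i ∧ ψ₂.Holds π i
  | .next ψ, i => ψ.Holds π (i · + 1)
  | .untl ψ₁ ψ₂, i => ∃ k, ψ₂.Holds π (i · + k) ∧ ∀ l < k, ψ₁.Holds π (i · + l)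

theorem PAssign.shift_univ_some {AP Var : Type*} (π : Var → Trace AP) (i : Var → ℕ) (k : ℕ) :
    PAssign.shift (fun x => some (π x, i x)) Set.univ k = fun x => some (π x, i x + k) := by
  funext x
  simp [PAssign.shift]

theorem QF.sat_toQFC_iff_holds {AP Var : Type*} (π : Var → Trace AP) (ψ : QF AP Var)
    (i : Var → ℕ) :
    ψ.toQFC.Sat (fun x => some (π x, i x)) Set.univ ↔ ψ.Holds π i := by
  induction ψ generalizing i with
  | top => rfl
  | atom p x =>
    simp only [toQFC, QFC.Sat, Holds, Option.some.injEq, Prod.mk.injEq]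
    exact ⟨by rintro ⟨_, _, ⟨rfl, rfl⟩, h⟩; exact h, fun h => ⟨_, _, ⟨rfl, rfl⟩, h⟩⟩
  | neg ψ ih => simp only [toQFC, QFC.Sat, Holds, ih]
  | and ψ₁ ψ₂ ih₁ ih₂ => simp only [toQFC, QFC.Sat, Holds, ih₁, ih₂]
  | next ψ ih => simp only [toQFC, QFC.Sat, Holds, PAssign.shift_univ_some, ih]
  | untl ψ₁ ψ₂ ih₁ ih₂ => simp only [toQFC, QFC.Sat, Holds, PAssign.shift_univ_some, ih₁, ih₂]

theorem uFormula_models_iff {AP : Type*} (L : Set (Trace AP)) (ψ₀ ψ : QF AP (Fin 2)) :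
    (uFormula ψ₀ ψ).Models L ↔ ∃ π₁ ∈ L, ∃ π₂ ∈ L, ψ₀.Holds ![π₁, π₂] ![0, 0] ∧
      ∃ n, ψ.Holds ![π₁, π₂] ![0, n] := by
  have huniv : ({0, 1} : Set (Fin 2)) = Set.univ := by
    ext x; fin_cases x <;> simp
  have hbind (π₁ π₂ : Trace AP) : PAssign.bind (PAssign.bind (fun _ => none) (0 : Fin 2) π₁) 1 π₂
      = fun x => some (![π₁, π₂] x, ![0, 0] x) := by
    funext x; fin_cases x <;> simp [PAssign.bind]
  have hshift (π₁ π₂ : Trace AP) (n : ℕ) :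
      PAssign.shift (fun x : Fin 2 => some (![π₁, π₂] x, ![0, 0] x)) {1} n
      = fun x => some (![π₁, π₂] x, ![0, n] x) := by
    funext x; fin_cases x <;> simp [PAssign.shift]
  simp only [Expr.Models, uFormula, Expr.Sat, QFC.eventually, QFC.Sat, hbind, hshift, huniv,
    QF.sat_toQFC_iff_holds, implies_true, and_true]

/-! ### Derived connectives -/

namespace QF

variable {AP Var : Type*}

/-- `ψ₁ → ψ₂`. -/
def imp (ψ₁ ψ₂ : QF AP Var) : QF AP Var := .neg (.and ψ₁ (.neg ψ₂))

/-- `F ψ`. -/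
def eventually (ψ : QF AP Var) : QF AP Var := .untl .top ψ

/-- `G ψ`. -/
def always (ψ : QF AP Var) : QF AP Var := .neg (eventually (.neg ψ))

/-- The conjunction of the formulas `f a` for `a` in a finite set. -/
noncomputable def conj {ι : Type*} (s : Finset ι) (f : ι → QF AP Var) : QF AP Var :=
  s.toList.foldr (fun a ψ => .and (f a) ψ) .top

/-- The disjunction of the formulas `f a` for `a` in a finite set. -/
noncomputable def disj {ι : Type*} (s : Finset ι) (f : ι → QF AP Var) : QF AP Var :=
  .neg (conj s fun a => .neg (f a))

variable (π : Var → Trace AP) (i : Var → ℕ)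

@[simp] theorem holds_atom (p : AP) (x : Var) : (atom p x).Holds π i ↔ p ∈ π x (i x) := Iff.rfl

@[simp] theorem holds_neg (ψ : QF AP Var) : (neg ψ).Holds π i ↔ ¬ ψ.Holds π i := Iff.rfl

@[simp] theorem holds_and (ψ₁ ψ₂ : QF AP Var) :
    (and ψ₁ ψ₂).Holds π i ↔ ψ₁.Holds π i ∧ ψ₂.Holds π i := Iff.rfl

@[simp] theorem holds_next (ψ : QF AP Var) : (next ψ).Holds π i ↔ ψ.Holds π (i · + 1) := Iff.rfl

@[simp] theorem holds_untl (ψ₁ ψ₂ : QF AP Var) : (untl ψ₁ ψ₂).Holds π i ↔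
    ∃ k, ψ₂.Holds π (i · + k) ∧ ∀ l < k, ψ₁.Holds π (i · + l) := Iff.rfl

@[simp] theorem holds_imp (ψ₁ ψ₂ : QF AP Var) :
    (imp ψ₁ ψ₂).Holds π i ↔ (ψ₁.Holds π i → ψ₂.Holds π i) := by
  simp [imp]

@[simp] theorem holds_eventually (ψ : QF AP Var) :
    (eventually ψ).Holds π i ↔ ∃ k, ψ.Holds π (i · + k) := by
  simp [eventually, Holds]

@[simp] theorem holds_always (ψ : QF AP Var) :
    (always ψ).Holds π i ↔ ∀ k, ψ.Holds π (i · + k) := by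
  simp [always]

@[simp] theorem holds_conj {ι : Type*} (s : Finset ι) (f : ι → QF AP Var) :
    (conj s f).Holds π i ↔ ∀ a ∈ s, (f a).Holds π i := by
  have (l : List ι) : (l.foldr (fun a ψ => .and (f a) ψ) .top : QF AP Var).Holds π i ↔
      ∀ a ∈ l, (f a).Holds π i := by
    induction l with
    | nil => simp [Holds]
    | cons a l ih => simp [ih]
  simp [conj, this]

@[simp] theorem holds_disj {ι : Type*} (s : Finset ι) (f : ι → QF AP Var) :
    (disj s f).Holds π i ↔ ∃ a ∈ s, (f a).Holds π i := by
  simp [disj]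

/-- The letters of `l`, then letters `b` up to a letter `m`, which does not occur again. -/
def initial (b m : AP) (x : Var) : List AP → QF AP Var
  | [] => .untl (.atom b x) (.and (.atom m x) (.next (always (.neg (.atom m x)))))
  | a :: l => .and (.atom a x) (.next (initial b m x l))

end QF

/-! ### The Kripke structure of all words over a finite alphabet -/

/-- The complete Kripke structure with `k` states, all of them initial, in which the state `s` is
labelled with the proposition `s` only. -/
def KripkeCode.full (k : ℕ) : KripkeCode where
  numStates := k
  initList := List.range k
  edgeList := List.range k ×ˢ List.range k
  labelList := (List.range k).map fun s => (s, s)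

/-- The trace in which exactly the proposition `w i` holds at the position `i`. -/
def wordTrace {k : ℕ} (w : ℕ → Fin k) : Trace ℕ := fun i => {(w i : ℕ)}

theorem KripkeCode.traces_full (k : ℕ) :
    (KripkeCode.full k).toKripke.traces = Set.range (wordTrace (k := k)) := by
  have hval (s : Fin k) : (KripkeCode.full k).toKripke.val s = {(s : ℕ)} := by
    ext p
    simp only [toKripke, full, List.mem_map, List.mem_range, Prod.mk.injEq, Set.mem_ofPred_eq,
      Set.mem_singleton_iff]
    exact ⟨by rintro ⟨a, -, h, rfl⟩; exact h.symm ▸ rfl, fun h => ⟨s, s.2, rfl, h.symm⟩⟩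
  ext π
  constructor
  · rintro ⟨t, -, ht⟩
    exact ⟨t, funext fun i => ((ht i).trans (hval (t i))).symm⟩
  · rintro ⟨w, rfl⟩
    refine ⟨w, ⟨?_, fun i => ?_⟩, fun i => (hval (w i)).symm⟩
    · exact List.mem_range.2 (w 0).2
    · exact List.pair_mem_product.2 ⟨List.mem_range.2 (w i).2, List.mem_range.2 (w (i + 1)).2⟩

/-! ### Spiral words -/

/-- There is a word `w` and a distance `n` such that the first `n` letters of `w` are the letter
`s`, some letters `b`, the list `u` and some letters `b`; the letter `m` occurs at the position `n`
and not later; each factor of three letters is related by `R` to the letter at distance `n` from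
its middle; and some letter satisfies `H`. -/
def Spiral {A : Type*} (s b m : A) (R : A → A → A → A → Prop) (H : A → Prop) (u : List A) : Prop :=
  ∃ (w : ℕ → A) (c d n : ℕ), n = 1 + c + u.length + d ∧
    w 0 = s ∧ (∀ j < c, w (1 + j) = b) ∧ (∀ j (h : j < u.length), w (1 + c + j) = u[j]) ∧
    (∀ j < d, w (1 + c + u.length + j) = b) ∧ w n = m ∧ (∀ j, w (n + 1 + j) ≠ m) ∧
    (∀ i, R (w i) (w (i + 1)) (w (i + 2)) (w (i + n + 1))) ∧ ∃ i, H (w i)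

section SpiralFormula

variable {A : Type*} {k : ℕ} {e : A ≃ Fin k} (w v : ℕ → A)

@[simp] theorem QF.holds_atom_zero (a : A) (i : Fin 2 → ℕ) :
    (QF.atom (e a : ℕ) 0).Holds ![wordTrace (e ∘ w), wordTrace (e ∘ v)] i ↔ w (i 0) = a := by
  simp [wordTrace, Fin.val_inj, eq_comm]

@[simp] theorem QF.holds_atom_one (a : A) (i : Fin 2 → ℕ) :
    (QF.atom (e a : ℕ) 1).Holds ![wordTrace (e ∘ w), wordTrace (e ∘ v)] i ↔ v (i 1) = a := by
  simp [wordTrace, Fin.val_inj, eq_comm]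

theorem QF.holds_initial (b m : A) (u : List A) (i : Fin 2 → ℕ) :
    (QF.initial (e b : ℕ) (e m) 0 (u.map fun a => (e a : ℕ))).Holds
      ![wordTrace (e ∘ w), wordTrace (e ∘ v)] i ↔
    (∀ j (h : j < u.length), w (i 0 + j) = u[j]) ∧ ∃ d, (∀ j < d, w (i 0 + u.length + j) = b) ∧
      w (i 0 + u.length + d) = m ∧ ∀ j, w (i 0 + u.length + d + 1 + j) ≠ m := by
  induction u generalizing i with
  | nil =>
    simp only [List.map_nil, initial, holds_untl, holds_and, holds_next, holds_always, holds_neg,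
      holds_atom_zero, List.length_nil, Nat.not_lt_zero, IsEmpty.forall_iff, implies_true,
      true_and, Nat.add_zero]
    exact exists_congr fun d => and_comm
  | cons a u ih =>
    have hadd (j : ℕ) : i 0 + 1 + u.length + j = i 0 + (u.length + 1) + j := by omega
    simp only [List.map_cons, initial, holds_and, holds_next, ih, holds_atom_zero,
      List.length_cons, ← and_assoc, hadd]
    refine and_congr_left' ⟨fun ⟨h₀, h⟩ j hj => ?_, fun h => ⟨h 0 (by omega), fun j hj => ?_⟩⟩
    · cases j with
      | zero => exact h₀
      | succ j => simpa [Nat.add_assoc, Nat.add_comm 1] using h j (by omega)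
    · have := h (j + 1) (by omega)
      rwa [List.getElem_cons_succ, ← Nat.add_assoc, Nat.add_right_comm] at this

variable [Fintype A] (e)

/-- The condition on the first row and on the letters that occur, together with the condition that
both traces agree. -/
noncomputable def spiralInit (s b m : A) (H : A → Prop) (u : List A) : QF ℕ (Fin 2) :=
  open Classical in
  .and (.atom (e s) 0) <| .and
    (.next (.untl (.atom (e b) 0) (.initial (e b : ℕ) (e m) 0 (u.map fun a => (e a : ℕ))))) <| .and
    (.always (.conj Finset.univ fun a => .imp (.atom (e a) 0) (.atom (e a) 1)))
    (.eventually (.disj {a | H a} fun a => .atom (e a) 0))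

/-- The condition that relates each row to the next one. -/
noncomputable def spiralStep (m : A) (R : A → A → A → A → Prop) : QF ℕ (Fin 2) :=
  open Classical in
  .and (.atom (e m) 1) <| .always <|
    -- The alphabet is finite, so `R` is enforced by forbidding each quadruple outside it. The atom
    -- on the second trace is under one `next`, hence it is read below the middle letter.
    .conj {a : A × A × A × A | ¬ R a.1 a.2.1 a.2.2.1 a.2.2.2} fun a => .neg <|
      .and (.atom (e a.1) 0) <| .next <| .and (.atom (e a.2.1) 0) <| .and (.atom (e a.2.2.2) 1) <|
      .next (.atom (e a.2.2.1) 0)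

variable {w v e}

theorem holds_spiralInit_iff (s b m : A) (H : A → Prop) (u : List A) :
    (spiralInit e s b m H u).Holds ![wordTrace (e ∘ w), wordTrace (e ∘ v)] ![0, 0] ↔
    v = w ∧ ∃ c d, w 0 = s ∧ (∀ j < c, w (1 + j) = b) ∧
      (∀ j (h : j < u.length), w (1 + c + j) = u[j]) ∧
      (∀ j < d, w (1 + c + u.length + j) = b) ∧ w (1 + c + u.length + d) = m ∧
      (∀ j, w (1 + c + u.length + d + 1 + j) ≠ m) ∧ ∃ i, H (w i) := by
  simp only [spiralInit, QF.holds_and, QF.holds_atom_zero, QF.holds_atom_one, QF.holds_next,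
    QF.holds_untl, QF.holds_always, QF.holds_eventually, QF.holds_conj, QF.holds_disj,
    QF.holds_imp, QF.holds_initial, Finset.mem_univ, Finset.mem_filter, true_and,
    Matrix.cons_val_zero, Matrix.cons_val_one, Nat.zero_add]
  constructor
  · rintro ⟨h₀, ⟨c, ⟨hu, d, hd, hm, hm'⟩, hc⟩, hv, i, a, ha, rfl⟩
    exact ⟨funext fun j => hv j _ trivial rfl, c, d, h₀, hc, hu, hd, hm, hm', i, ha⟩
  · rintro ⟨rfl, c, d, h₀, hc, hu, hd, hm, hm', i, ha⟩
    exact ⟨h₀, ⟨c, ⟨hu, d, hd, hm, hm'⟩, hc⟩, fun _ _ _ h => h, i, _, ha, rfl⟩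

theorem holds_spiralStep_iff (m : A) (R : A → A → A → A → Prop) (n : ℕ) :
    (spiralStep e m R).Holds ![wordTrace (e ∘ w), wordTrace (e ∘ v)] ![0, n] ↔
    v n = m ∧ ∀ i, R (w i) (w (i + 1)) (w (i + 2)) (v (i + n + 1)) := by
  simp only [spiralStep, QF.holds_and, QF.holds_atom_zero, QF.holds_atom_one, QF.holds_next,
    QF.holds_always, QF.holds_conj, QF.holds_neg, Finset.mem_filter, Finset.mem_univ, true_and,
    Matrix.cons_val_zero, Matrix.cons_val_one, Nat.zero_add]
  refine and_congr_right fun _ => forall_congr' fun i => ⟨fun h => ?_, ?_⟩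
  · by_contra hR
    exact h (w i, w (i + 1), w (i + 2), v (i + n + 1)) hR ⟨rfl, rfl, by rw [Nat.add_comm n], rfl⟩
  · rintro hR ⟨_, _, _, _⟩ hR' ⟨rfl, rfl, rfl, rfl⟩
    exact hR' (Nat.add_comm n i ▸ hR)

/-- The step formula only says that `m` is at the offset `n`. The letters of the first row differ
from `m` and `m` does not recur later, so `n` must be the length of that row. -/
theorem uModelChecking_iff_spiral {s b m : A} (R : A → A → A → A → Prop) (H : A → Prop)
    {u : List A} (hs : s ≠ m) (hb : b ≠ m) (hu : m ∉ u) :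
    UModelChecking (KripkeCode.full k, spiralInit e s b m H u, spiralStep e m R) ↔
      Spiral s b m R H u := by
  have hword (t : ℕ → Fin k) : wordTrace t = wordTrace (e ∘ e.symm ∘ t) := by
    congr 1; ext; simp
  rw [UModelChecking, uFormula_models_iff, KripkeCode.traces_full]
  constructor
  · rintro ⟨_, ⟨w, rfl⟩, _, ⟨v, rfl⟩, h₀, n, h₁⟩
    rw [hword w, hword v] at h₀ h₁
    rw [holds_spiralInit_iff] at h₀
    rw [holds_spiralStep_iff] at h₁
    generalize e.symm ∘ w = w at h₀ h₁
    generalize e.symm ∘ v = v at h₀ h₁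
    obtain ⟨rfl, c, d, h0, hc, hl, hd, hm, hm', hH⟩ := h₀
    obtain ⟨hn, hR⟩ := h₁
    have hnd : n = 1 + c + u.length + d := by
      rcases lt_trichotomy n (1 + c + u.length + d) with h | h | h
      · exfalso
        rcases Nat.eq_zero_or_pos n with rfl | hpos
        · exact hs (h0.symm.trans hn)
        · by_cases h1 : n < 1 + c
          · refine hb ((hc (n - 1) (by omega)).symm.trans ?_)
            rwa [Nat.add_sub_cancel' hpos]
          · by_cases h2 : n < 1 + c + u.length
            · have := hl (n - (1 + c)) (by omega)
              rw [Nat.add_sub_cancel' (by omega), hn] at this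
              exact hu (this ▸ List.getElem_mem _)
            · refine hb ((hd (n - (1 + c + u.length)) (by omega)).symm.trans ?_)
              rwa [Nat.add_sub_cancel' (by omega)]
      · exact h
      · exfalso
        refine hm' (n - (1 + c + u.length + d + 1)) ?_
        rwa [Nat.add_sub_cancel' (by omega)]
    subst hnd
    exact ⟨v, c, d, _, rfl, h0, hc, hl, hd, hm, hm', hR, hH⟩
  · rintro ⟨w, c, d, n, rfl, h0, hc, hl, hd, hm, hm', hR, hH⟩
    exact ⟨_, ⟨e ∘ w, rfl⟩, _, ⟨e ∘ w, rfl⟩,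
      (holds_spiralInit_iff s b m H u).2 ⟨rfl, c, d, h0, hc, hl, hd, hm, hm', hH⟩, _,
      (holds_spiralStep_iff m R _).2 ⟨hm, hR⟩⟩

end SpiralFormula

/-! ### Computability of the reduction -/

/-- A fold on Gödel numbers is the form to which `Primrec.list_foldr` applies. -/
theorem QF.toNat_initial (b m : ℕ) (x : Fin 2) (l : List ℕ) :
    (QF.initial b m x l).toNat = l.foldr
      (fun a c => 5 * Nat.pair (5 * (2 * a + x) + 1) (5 * c + 3) + 4)
      (QF.initial b m x []).toNat := by
  induction l with
  | nil => rfl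
  | cons a l ih => simp [QF.initial, QF.toNat, ih]

/-- `QF.toNat` is the encoding of `QF.instDenumerable`, so computability of the constructors is
arithmetic on Gödel numbers. -/
theorem QF.primrec_toNat : Primrec QF.toNat := Primrec.encode

theorem QF.primrec_initial (b m : ℕ) (x : Fin 2) : Primrec (QF.initial b m x) := by
  have h : Primrec₂ fun (_ : List ℕ) (p : ℕ × ℕ) =>
      5 * Nat.pair (5 * (2 * p.1 + (x : ℕ)) + 1) (5 * p.2 + 3) + 4 := by
    have hmul (a b : ℕ) {f : List ℕ × ℕ × ℕ → ℕ} (hf : Primrec f) :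
        Primrec fun p => a * f p + b :=
      Primrec.nat_add.comp (Primrec.nat_mul.comp (Primrec.const a) hf) (Primrec.const b)
    exact hmul 5 4 (Primrec₂.natPair.comp (hmul 5 1 (hmul 2 x (Primrec.fst.comp Primrec.snd)))
      (hmul 5 3 (Primrec.snd.comp Primrec.snd)))
  exact Primrec.encode_iff.1 ((Primrec.list_foldr Primrec.id (Primrec.const _) h).of_eq fun l =>
    (QF.toNat_initial b m x l).symm)

theorem QF.primrec_and : Primrec₂ (QF.and : QF ℕ (Fin 2) → _ → _) := by
  refine Primrec.encode_iff.1 ?_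
  exact Primrec.nat_add.comp (Primrec.nat_mul.comp (Primrec.const 5) (Primrec₂.natPair.comp
    (QF.primrec_toNat.comp Primrec.fst) (QF.primrec_toNat.comp Primrec.snd))) (Primrec.const 4)

theorem QF.primrec_untl : Primrec₂ (QF.untl : QF ℕ (Fin 2) → _ → _) := by
  refine Primrec.encode_iff.1 ?_
  exact Primrec.nat_add.comp (Primrec.nat_mul.comp (Primrec.const 5) (Primrec₂.natPair.comp
    (QF.primrec_toNat.comp Primrec.fst) (QF.primrec_toNat.comp Primrec.snd))) (Primrec.const 5)

theorem QF.primrec_next : Primrec (QF.next : QF ℕ (Fin 2) → _) := by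
  refine Primrec.encode_iff.1 ?_
  exact Primrec.nat_add.comp (Primrec.nat_mul.comp (Primrec.const 5) QF.primrec_toNat)
    (Primrec.const 3)

/-- Only `u` depends on the instance. All other parts of the output are constants, so it is harmless
that they are defined by choice. -/
theorem spiral_manyOneReducible {α A : Type*} [Primcodable α] [Fintype A] {k : ℕ} (e : A ≃ Fin k)
    {s b m : A} (R : A → A → A → A → Prop) (H : A → Prop) {u : α → List A} (hs : s ≠ m)
    (hb : b ≠ m) (hu : ∀ a, m ∉ u a)
    (hcomp : Computable fun a => (u a).map fun c => (e c : ℕ)) :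
    (fun a => Spiral s b m R H (u a)) ≤₀ UModelChecking := by
  refine ⟨fun a => (KripkeCode.full k, spiralInit e s b m H (u a), spiralStep e m R), ?_,
    fun a => (uModelChecking_iff_spiral R H hs hb (hu a)).symm⟩
  refine Computable.pair (Computable.const _) (Computable.pair ?_ (Computable.const _))
  have h := (QF.primrec_initial (e b) (e m) 0).to_comp.comp hcomp
  exact QF.primrec_and.to_comp.comp (Computable.const _) (QF.primrec_and.to_comp.comp
    (QF.primrec_next.to_comp.comp (QF.primrec_untl.to_comp.comp (Computable.const _) h))
    (Computable.const _))

open Turing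

/-! ### Turing machines with an absolute head position -/

section Halting

variable {σ : Type*} (f : σ → Option σ)

/-- The step function `f`, where halting configurations do not change. -/
def totalStep (a : σ) : σ := (f a).getD a

theorem eval_dom_iff_iterate (a : σ) :
    (StateTransition.eval f a).Dom ↔ ∃ t, f ((totalStep f)^[t] a) = none := by
  constructor
  · intro h
    obtain ⟨hr, hn⟩ := StateTransition.mem_eval.1 (Part.get_mem h)
    suffices ∃ t, (totalStep f)^[t] a = (StateTransition.eval f a).get h from
      this.imp fun t ht => by rw [ht, hn]
    generalize (StateTransition.eval f a).get h = b at hr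
    clear hn h
    induction hr using Relation.ReflTransGen.head_induction_on with
    | refl => exact ⟨0, rfl⟩
    | head hbc _ ih =>
      obtain ⟨t, ht⟩ := ih
      exact ⟨t + 1, by rwa [Function.iterate_succ_apply, totalStep, Option.mem_def.1 hbc]⟩
  · rintro ⟨t, ht⟩
    suffices StateTransition.Reaches f a ((totalStep f)^[t] a) from
      Part.dom_iff_mem.2 ⟨_, StateTransition.mem_eval.2 ⟨this, ht⟩⟩
    clear ht
    induction t with
    | zero => exact .refl
    | succ t ih =>
      rw [Function.iterate_succ_apply', totalStep]
      cases h : f ((totalStep f)^[t] a) with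
      | none => exact ih
      | some b => exact ih.tail h

theorem iterate_totalStep_of_le {a : σ} {s t : ℕ} (hs : f ((totalStep f)^[s] a) = none)
    (hst : s ≤ t) : (totalStep f)^[t] a = (totalStep f)^[s] a := by
  induction t, hst using Nat.le_induction with
  | base => rfl
  | succ t _ ih => rw [Function.iterate_succ_apply', ih, totalStep, hs, Option.getD_none]

end Halting

/-- A configuration of a Turing machine whose tape cells are numbered by the integers. -/
structure ZCfg (Γ Λ : Type*) where
  /-- The current state. -/
  q : Λ
  /-- The position of the head. -/
  pos : ℤ
  /-- The content of the tape. -/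
  tape : ℤ → Γ

/-- The displacement of a head move. -/
def dirInt : Dir → ℤ
  | .left => -1
  | .right => 1

namespace ZCfg

variable {Γ Λ : Type*} [Inhabited Λ]

/-- The configuration after a statement has been executed. -/
def exec (c : ZCfg Γ Λ) (q : Λ) : TM0.Stmt Γ → ZCfg Γ Λ
  | .move d => ⟨q, c.pos + dirInt d, c.tape⟩
  | .write a => ⟨q, c.pos, Function.update c.tape c.pos a⟩

/-- One step of a machine. -/
def step (M : TM0.Machine Γ Λ) (c : ZCfg Γ Λ) : Option (ZCfg Γ Λ) :=
  (M c.q (c.tape c.pos)).map fun p => c.exec p.1 p.2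

theorem step_eq_none {M : TM0.Machine Γ Λ} {c : ZCfg Γ Λ} :
    c.step M = none ↔ M c.q (c.tape c.pos) = none := Option.map_eq_none_iff

variable [Inhabited Γ]

/-- The initial configuration on a given input. -/
def init (l : List Γ) : ZCfg Γ Λ := ⟨default, 0, (Tape.mk₁ l).nth⟩

/-- `TM0` numbers cells relative to the head, but the columns of a diagram need fixed cells. The
relation is the change of coordinates. -/
theorem step_respects (M : TM0.Machine Γ Λ) :
    StateTransition.Respects (TM0.step M) (step M)
      fun a b => a.q = b.q ∧ ∀ z, b.tape (b.pos + z) = a.Tape.nth z := by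
  rintro ⟨q, T⟩ ⟨_, h, U⟩ ⟨rfl, hT⟩
  dsimp only at hT
  have h0 : U h = T.1 := by simpa using hT 0
  simp only [TM0.step]
  cases hM : M q T.1 with
  | none => exact step_eq_none.2 (by simpa [h0] using hM)
  | some p =>
    obtain ⟨q', s⟩ := p
    refine ⟨_, ?_, .single (b := exec ⟨q, h, U⟩ q' s) (by simp [step, h0, hM])⟩
    rcases s with (_ | _) | a
    · exact ⟨rfl, fun z => by
        simpa [exec, dirInt, Tape.move_left_nth, add_assoc, ← sub_eq_neg_add] using hT (z - 1)⟩
    · exact ⟨rfl, fun z => by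
        simpa [exec, dirInt, Tape.move_right_nth, add_assoc, add_comm z] using hT (z + 1)⟩
    · exact ⟨rfl, fun z => by simp [exec, Tape.write_nth, Function.update_apply, hT]⟩

theorem eval_dom_iff (M : TM0.Machine Γ Λ) (l : List Γ) :
    (TM0.eval M l).Dom ↔ ∃ t, ((totalStep (step M))^[t] (init l)).step M = none := by
  rw [← eval_dom_iff_iterate]
  exact (StateTransition.tr_eval_dom (step_respects M) (by simp [init, TM0.init])).symm

omit [Inhabited Γ] in
theorem abs_pos_totalStep_sub_le (M : TM0.Machine Γ Λ) (c : ZCfg Γ Λ) :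
    |(totalStep (step M) c).pos - c.pos| ≤ 1 := by
  simp only [totalStep, step]
  rcases M c.q (c.tape c.pos) with _ | ⟨q, (_ | _) | a⟩ <;> simp [exec, dirInt]

omit [Inhabited Γ] in
theorem abs_pos_iterate_le (M : TM0.Machine Γ Λ) (c : ZCfg Γ Λ) (t : ℕ) :
    |((totalStep (step M))^[t] c).pos| ≤ |c.pos| + t := by
  induction t with
  | zero => simp
  | succ t ih =>
    rw [Function.iterate_succ_apply']
    have := abs_pos_totalStep_sub_le M ((totalStep (step M))^[t] c)
    push_cast
    grind

end ZCfg

/-! ### Space-time diagrams of Turing machines as spiral words -/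

/-- The letters of a space-time diagram: two separators and the tape cells, which carry a tape symbol
and, at the position of the head, the current state. -/
abbrev Letter (Γ Λ : Type*) := Bool ⊕ Γ × Option Λ

section Diagram

variable {Γ Λ : Type*} [Inhabited Λ] (M : TM0.Machine Γ Λ)

/-- The state of a head that leaves the given cell in the given direction. -/
def leaving (d : Dir) : Letter Γ Λ → Option Λ
  | .inr (g, some q) =>
    match M q g with
    | some (q', .move d') => if d' = d then some q' else none
    | _ => none
  | _ => none

/-- The new content of a cell, not taking into account heads that arrive from neighbouring cells. -/
def remaining : Γ × Option Λ → Γ × Option Λ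
  | (g, some q) =>
    match M q g with
    -- A halted head stays in place, in accordance with `totalStep`, so the diagram goes on forever.
    | none => (g, some q)
    | some (_, .move _) => (g, none)
    | some (q', .write g') => (g', some q')
  | (g, none) => (g, none)

/-- The new content of a cell, given its left neighbour, its content and its right neighbour. -/
def nextCell (a : Letter Γ Λ) (b : Γ × Option Λ) (c : Letter Γ Λ) : Γ × Option Λ :=
  -- With a single head, at most one alternative differs from `none`, so their order is irrelevant.
  ((remaining M b).1, (remaining M b).2 <|> leaving M .right a <|> leaving M .left c)

/-- The relation between three adjacent letters and the letter below the middle one. It excludes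
heads next to separators. -/
def StepRel (a b c d : Letter Γ Λ) : Prop :=
  match b with
  -- The marker `.inl true` is not copied, so it can occur only once.
  | .inl _ => d = .inl false
  | .inr b => d = .inr (nextCell M a b c) ∧ (b.2.isSome → a.isRight ∧ c.isRight)

/-- The letter is a cell with a head that halts. -/
def IsHalting (a : Letter Γ Λ) : Prop := ∃ g q, a = .inr (g, some q) ∧ M q g = none

/-- The letters that encode the input. -/
def inputLetters [Inhabited Γ] (l : List Γ) : List (Letter Γ Λ) :=
  .inr (l.headI, some default) :: l.tail.map fun g => .inr (g, none)

/-! ### Configurations as rows of letters -/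

namespace ZCfg

/-- The cell number `z` of a configuration. -/
def cell (c : ZCfg Γ Λ) (z : ℤ) : Γ × Option Λ := (c.tape z, if z = c.pos then some c.q else none)

variable {M}

omit [Inhabited Λ] in
theorem cell_pos (c : ZCfg Γ Λ) : c.cell c.pos = (c.tape c.pos, some c.q) := by simp [cell]

omit [Inhabited Λ] in
theorem cell_of_ne {c : ZCfg Γ Λ} {z : ℤ} (h : z ≠ c.pos) : c.cell z = (c.tape z, none) := by
  simp [cell, h]

theorem isHalting_cell_iff {c : ZCfg Γ Λ} {z : ℤ} :
    IsHalting M (.inr (c.cell z)) ↔ z = c.pos ∧ c.step M = none := by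
  rw [step_eq_none, IsHalting]
  by_cases h : z = c.pos
  · subst h
    simp only [cell_pos, Sum.inr.injEq, Prod.mk.injEq, Option.some.injEq, true_and]
    exact ⟨by rintro ⟨_, _, ⟨rfl, rfl⟩, h⟩; exact h, fun h => ⟨_, _, ⟨rfl, rfl⟩, h⟩⟩
  · simp [cell_of_ne h, h]

theorem leaving_cell_of_ne {c : ZCfg Γ Λ} {z : ℤ} (h : z ≠ c.pos) (d : Dir) :
    leaving M d (.inr (c.cell z)) = none := by
  simp [cell_of_ne h, leaving]

/-- The neighbours matter only through the heads they emit. A separator can therefore stand in for a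
cell without a head at either end of a row. -/
theorem cell_totalStep (c : ZCfg Γ Λ) (z : ℤ) {a b : Letter Γ Λ}
    (ha : leaving M .right a = leaving M .right (.inr (c.cell (z - 1))))
    (hb : leaving M .left b = leaving M .left (.inr (c.cell (z + 1)))) :
    (totalStep (step M) c).cell z = nextCell M a (c.cell z) b := by
  rw [nextCell, ha, hb, totalStep]
  obtain ⟨q, h, T⟩ := c
  rcases hM : M q (T h) with _ | ⟨q', (_ | _) | g⟩ <;> simp only [step, hM, Option.map_none,
    Option.map_some, Option.getD_none, Option.getD_some, exec, dirInt]
  all_goals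
    rcases eq_or_ne z h with rfl | hz
    · simp [cell, remaining, leaving, hM]
    rcases eq_or_ne (z - 1) h with rfl | hz₁
    · have h₁ : z ≠ z - 1 + -1 := by omega
      have h₂ : z + 1 ≠ z - 1 := by omega
      simp [cell, remaining, leaving, hM, hz, h₁, h₂]
    rcases eq_or_ne (z + 1) h with rfl | hz₂
    · have h₁ : z ≠ z + 1 + 1 := by omega
      simp [cell, remaining, leaving, hM, hz, hz₁, h₁]
    have h₁ : z ≠ h + 1 := by omega
    have h₂ : z ≠ h + -1 := by omega
    simp [cell, remaining, leaving, hz, hz₁, hz₂, h₁, h₂]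

variable [Inhabited Γ]

omit [Inhabited Λ] in
theorem _root_.Turing.Tape.mk₁_nth_natCast (l : List Γ) (n : ℕ) :
    (Tape.mk₁ l).nth n = l.getI n := by
  rw [Tape.mk₁, Tape.mk₂, Tape.mk'_nth_nat, ListBlank.nth_mk]

omit [Inhabited Λ] in
theorem _root_.Turing.Tape.mk₁_nth_of_neg (l : List Γ) {z : ℤ} (hz : z < 0) :
    (Tape.mk₁ l).nth z = default := by
  obtain ⟨n, rfl⟩ := Int.eq_negSucc_of_lt_zero hz
  exact (ListBlank.nth_mk _ _).trans (List.getI_nil _)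

theorem cell_init_of_neg (l : List Γ) {z : ℤ} (hz : z < 0) :
    (init l : ZCfg Γ Λ).cell z = (default, none) := by
  simp [cell, init, Tape.mk₁_nth_of_neg l hz, hz.ne]

theorem getElem_inputLetters (l : List Γ) {j : ℕ} (hj : j < (inputLetters (Λ := Λ) l).length) :
    (inputLetters l)[j] = Sum.inr ((init l : ZCfg Γ Λ).cell j) := by
  simp only [cell, init, Tape.mk₁_nth_natCast, Nat.cast_eq_zero]
  rcases l with _ | ⟨g, l⟩ <;> rcases j with _ | j <;> simp [inputLetters] at hj ⊢
  exact (List.getI_eq_getElem _ hj).symm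

theorem cell_init_of_length_le (l : List Γ) {j : ℕ}
    (hj : (inputLetters (Λ := Λ) l).length ≤ j) :
    (init l : ZCfg Γ Λ).cell j = (default, none) := by
  simp only [cell, init, Tape.mk₁_nth_natCast, Nat.cast_eq_zero]
  rcases l with _ | ⟨g, l⟩ <;> rcases j with _ | j <;> simp [inputLetters] at hj ⊢
  exact List.getI_eq_default _ hj

end ZCfg

-- From a spiral word to halting: by induction, row `t` is the configuration `C t`, because the ban
-- on heads next to separators keeps the head inside the row. Conversely, a machine that halts after
-- `T` steps stays within distance `T` of the origin, so its diagram fits between separators.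
open ZCfg in
theorem spiral_iff_eval_dom [Inhabited Γ] (l : List Γ) :
    Spiral (.inl false) (.inr (default, none)) (.inl true) (StepRel M) (IsHalting M)
      (inputLetters l) ↔ (TM0.eval M l).Dom := by
  rw [ZCfg.eval_dom_iff]
  have hlen : 1 ≤ (inputLetters (Λ := Λ) l).length := by simp [inputLetters]
  set L := (inputLetters (Λ := Λ) l).length with hL
  set C : ℕ → ZCfg Γ Λ := fun t => (totalStep (step M))^[t] (init l) with hC
  have hC0 : C 0 = init l := rfl
  have hCs (t : ℕ) : C (t + 1) = totalStep (step M) (C t) := Function.iterate_succ_apply' ..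
  constructor
  · rintro ⟨w, c, d, n, hn, hw0, hc, hu, hd, hm, -, hR, i, hi⟩
    have hwall (t : ℕ) : ∃ x, w (t * n) = .inl x := by
      -- Position `0` is the middle of no factor, so the separator at `n` comes from the marker; the
      -- rule yields only the later ones.
      rcases t with _ | t
      · exact ⟨_, by simpa using hw0⟩
      induction t with
      | zero => exact ⟨_, by simpa using hm⟩
      | succ t ih =>
        obtain ⟨x, hx⟩ := ih
        have h := hR ((t + 1) * n - 1)
        have hpos : 0 < (t + 1) * n := Nat.mul_pos t.succ_pos (by omega)
        rw [Nat.sub_add_cancel hpos, hx] at h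
        refine ⟨false, Eq.trans ?_ h⟩
        congr 1
        rw [Nat.succ_mul (t + 1) n]
        omega
    -- Column `j` holds the tape cell `j - c`, as `c` blanks precede the input. The bounds keep the
    -- head inside the row.
    have hrow (t : ℕ) : (∀ j : ℕ, 1 + j < n → w (t * n + 1 + j) = .inr ((C t).cell (j - c))) ∧
        -c ≤ (C t).pos ∧ (C t).pos < n - 1 - c := by
      induction t with
      | zero =>
        refine ⟨fun j hj => ?_, ?_, ?_⟩
        · rw [hC0, Nat.zero_mul, Nat.zero_add]
          by_cases h₁ : j < c
          · rw [hc j h₁, cell_init_of_neg l (by omega)]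
          by_cases h₂ : j < c + L
          · obtain ⟨k, rfl⟩ := Nat.exists_eq_add_of_le (not_lt.1 h₁)
            rw [← Nat.add_assoc, hu k (by omega), getElem_inputLetters]
            simp
          · obtain ⟨k, rfl⟩ := Nat.exists_eq_add_of_le (not_lt.1 h₂)
            rw [← Nat.add_assoc, ← Nat.add_assoc, hd k (by omega),
              show ((c + L + k : ℕ) - c : ℤ) = (L + k : ℕ) by push_cast; ring,
              cell_init_of_length_le l (by omega)]
        · simp [hC0, init]
        · simp only [hC0, init]; omega
      | succ t ih =>
        obtain ⟨hcell, hl, hr⟩ := ih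
        obtain ⟨h, hh⟩ := Int.eq_ofNat_of_zero_le (a := (C t).pos + c) (by omega)
        have hwh := hcell h (by omega)
        rw [show (h : ℤ) - c = (C t).pos by omega, cell_pos] at hwh
        have hnb := hR (t * n + h)
        rw [Nat.add_right_comm _ h, hwh] at hnb
        obtain ⟨ha, hb⟩ := hnb.2 rfl
        -- In column `0` or `n - 2` the head would touch a separator. Away from both, one move
        -- cannot leave the row.
        have hh0 : h ≠ 0 := by
          rintro rfl
          obtain ⟨x, hx⟩ := hwall t
          simp [hx] at ha
        have hhn : h + 2 ≠ n := by
          rintro rfl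
          obtain ⟨x, hx⟩ := hwall (t + 1)
          rw [show t * (h + 2) + h + 2 = (t + 1) * (h + 2) by ring, hx] at hb
          simp at hb
        have hpos : |(C (t + 1)).pos - (C t).pos| ≤ 1 := by
          rw [hCs]; exact abs_pos_totalStep_sub_le M _
        rw [abs_le] at hpos
        refine ⟨fun j hj => ?_, by omega, by omega⟩
        have h := hR (t * n + j)
        rw [Nat.add_right_comm _ j, hcell j hj] at h
        rw [show (t + 1) * n + 1 + j = t * n + j + n + 1 by ring, h.1, hCs]
        congr 1
        symm
        apply cell_totalStep
        · rcases j with _ | j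
          · obtain ⟨x, hx⟩ := hwall t
            rw [leaving_cell_of_ne (by omega), Nat.add_zero, hx]; rfl
          · rw [show t * n + (j + 1) = t * n + 1 + j by ring, hcell j (by omega)]
            congr 3; push_cast; ring
        · rw [show t * n + j + 2 = t * n + 1 + (j + 1) by ring]
          by_cases hjn : 1 + (j + 1) < n
          · rw [hcell _ hjn]
            congr 3; push_cast; ring
          · obtain ⟨x, hx⟩ := hwall (t + 1)
            rw [leaving_cell_of_ne (by omega),
              show t * n + 1 + (j + 1) = (t + 1) * n by rw [Nat.add_mul]; omega, hx]
            rfl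
    refine ⟨i / n, ?_⟩
    have hi' : w (i / n * n + i % n) = w i := by rw [Nat.div_add_mod']
    have hmod := Nat.mod_lt i (show 0 < n by omega)
    rcases hin : i % n with _ | j
    · obtain ⟨x, hx⟩ := hwall (i / n)
      rw [hin, Nat.add_zero, hx] at hi'
      obtain ⟨g, q, h, -⟩ := hi
      simp [← hi'] at h
    · rw [hin, show i / n * n + (j + 1) = i / n * n + 1 + j by ring,
        (hrow (i / n)).1 j (by omega)] at hi'
      rw [← hi'] at hi
      exact (isHalting_cell_iff.1 hi).2
  · rintro ⟨T, hT⟩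
    have hpos (t : ℕ) : |(C t).pos| ≤ T := by
      rcases le_total t T with h | h
      · have := abs_pos_iterate_le M (init l) t
        simp only [init, abs_zero, zero_add] at this
        exact this.trans (by exact_mod_cast h)
      · have := abs_pos_iterate_le M (init l) T
        simp only [init, abs_zero, zero_add] at this
        exact (congrArg (|ZCfg.pos ·|) (iterate_totalStep_of_le _ hT h)).trans_le this
    simp only [abs_le] at hpos
    -- One more blank than `T` on each side keeps every head off the separators.
    set n := 1 + (T + 1) + L + (T + 1) with hn
    set w : ℕ → Letter Γ Λ := fun i =>
      -- Only the separator at `n` itself is the marker.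
      if i % n = 0 then .inl (i = n : Bool)
      else .inr ((C (i / n)).cell ((i % n : ℕ) - 1 - (T + 1))) with hw
    have hwall (t : ℕ) : w (t * n) = .inl (t = 1 : Bool) := by
      have hn0 : n ≠ 0 := by omega
      simp [hw, hn0]
    have hcell (t j : ℕ) (hj : 1 + j < n) :
        w (t * n + 1 + j) = .inr ((C t).cell (j - (T + 1))) := by
      have h₁ : (t * n + 1 + j) % n = 1 + j := by
        rw [Nat.add_assoc, Nat.mul_add_mod_self_right, Nat.mod_eq_of_lt hj]
      have h₂ : (t * n + 1 + j) / n = t := by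
        rw [Nat.add_assoc, Nat.mul_comm, Nat.mul_add_div (by omega), Nat.div_eq_of_lt hj,
          Nat.add_zero]
      simp only [hw, h₁, h₂]
      rw [if_neg (by omega)]
      congr 2
      push_cast
      ring
    have hcell0 (j : ℕ) (hj : 1 + j < n) : w (1 + j) = .inr ((init l).cell (j - (T + 1))) := by
      simpa [hC0] using hcell 0 j hj
    refine ⟨w, T + 1, T + 1, n, rfl, ?_, fun j hj => ?_, fun j hj => ?_, fun j hj => ?_, ?_,
      fun j hj => ?_, fun i => ?_, T * n + 1 + ((C T).pos + (T + 1)).toNat, ?_⟩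
    · simpa using hwall 0
    · rw [hcell0 j (by omega), cell_init_of_neg l (by omega)]
    · rw [Nat.add_assoc, hcell0 _ (by omega), getElem_inputLetters]
      simp
    · rw [Nat.add_assoc, Nat.add_assoc, hcell0 _ (by omega),
        show ((T + 1 + (L + j) : ℕ) - (T + 1) : ℤ) = (L + j : ℕ) by push_cast; ring,
        cell_init_of_length_le l (by omega)]
    · simpa using hwall 1
    · simp only [hw] at hj
      split_ifs at hj
      simp at hj
      omega
    · have hmod := Nat.mod_lt i (show 0 < n by omega)
      rw [← Nat.div_add_mod' i n]
      generalize i / n = t at *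
      generalize i % n = j at *
      rw [Nat.add_right_comm _ j]
      by_cases hj : 1 + j < n
      · rw [hcell t j hj]
        refine ⟨?_, fun h => ?_⟩
        · rw [show t * n + j + n + 1 = (t + 1) * n + 1 + j by ring, hcell _ j hj, hCs]
          congr 1
          apply cell_totalStep
          · rcases j with _ | j
            · rw [leaving_cell_of_ne (by have := hpos t; omega), Nat.add_zero, hwall]; rfl
            · rw [show t * n + (j + 1) = t * n + 1 + j by ring, hcell t j (by omega)]
              congr 3; push_cast; ring
          · rw [show t * n + j + 2 = t * n + 1 + (j + 1) by ring]
            by_cases hjn : 1 + (j + 1) < n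
            · rw [hcell _ _ hjn]
              congr 3; push_cast; ring
            · rw [leaving_cell_of_ne (by have := hpos t; omega),
                show t * n + 1 + (j + 1) = (t + 1) * n by rw [Nat.add_mul]; omega, hwall]
              rfl
        · have hjp : (j : ℤ) - (T + 1) = (C t).pos := by
            by_contra hne
            simp [cell_of_ne hne] at h
          have := hpos t
          obtain ⟨k, rfl⟩ : ∃ k, j = k + 1 := ⟨j - 1, by omega⟩
          rw [show t * n + (k + 1) = t * n + 1 + k by ring, hcell t k (by omega),
            show t * n + 1 + k + 2 = t * n + 1 + (k + 2) by ring, hcell t (k + 2) (by omega)]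
          exact ⟨rfl, rfl⟩
      · rw [show t * n + 1 + j = (t + 1) * n by rw [Nat.add_mul]; omega, hwall]
        rw [show t * n + j + n + 1 = (t + 1 + 1) * n by simp only [Nat.add_mul]; omega]
        simpa [StepRel] using hwall (t + 1 + 1)
    · have := hpos T
      have h0 : 0 ≤ (C T).pos + (T + 1) := by omega
      rw [hcell _ _ (by omega), Int.toNat_of_nonneg h0, add_sub_cancel_right, isHalting_cell_iff]
      exact ⟨rfl, hT⟩

end Diagram

/-! ### A finite Turing machine for a recursively enumerable predicate -/

/-- The state type of a translated machine may be infinite, but a finite set that contains the start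
state and is closed under transitions suffices for every run. -/
theorem exists_finite_TM0 {Γ Λ : Type} [Inhabited Γ] [Inhabited Λ] (M : TM0.Machine Γ Λ)
    {S : Finset Λ} (hS : TM0.Supports M (S : Set Λ)) :
    ∃ (Q : Type) (_ : Fintype Q) (_ : Inhabited Q) (N : TM0.Machine Γ Q),
      ∀ l, (TM0.eval N l).Dom ↔ (TM0.eval M l).Dom := by
  classical
  let i : Inhabited S := ⟨⟨default, hS.1⟩⟩
  let f : PointedMap Γ Γ := ⟨id, rfl⟩
  let g : PointedMap Λ S := ⟨fun q => if h : q ∈ S then ⟨q, h⟩ else default, dif_pos hS.1⟩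
  refine ⟨S, inferInstance, i, M.map f f g Subtype.val, fun l => ?_⟩
  refine StateTransition.tr_eval_dom (TM0.Machine.map_respects M f f g Subtype.val hS
    (fun _ => rfl) fun q hq => congrArg Subtype.val (dif_pos hq)) ⟨hS.1, ?_⟩
  rw [TM0.map_init]
  exact congrArg _ (List.map_id l)

theorem exists_finite_TM0_of_TM2 {K : Type} [DecidableEq K] {Γ : K → Type} {Λ σ : Type}
    [Inhabited Λ] [Inhabited σ] [Fintype σ] (M : Λ → TM2.Stmt Γ Λ σ) {S : Finset Λ}
    (hS : TM2.Supports M S) (k : K) :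
    ∃ (Q : Type) (_ : Fintype Q) (_ : Inhabited Q) (N : TM0.Machine (TM2to1.Γ' K Γ) Q),
      ∀ L, (TM0.eval N (TM2to1.trInit k L)).Dom ↔ (TM2.eval M k L).Dom := by
  obtain ⟨Q, hQ, iQ, N, hN⟩ :=
    exists_finite_TM0 _ (TM1to0.tr_supports _ (TM2to1.tr_supports M hS))
  exact ⟨Q, hQ, iQ, N, fun L => by rw [hN, TM1to0.tr_eval, TM2to1.tr_eval_dom]⟩

instance : Fintype PartrecToTM2.K' := ⟨{.main, .rev, .aux, .stack}, by rintro (_ | _) <;> simp⟩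

/-- The tape alphabet of the machines for partial recursive functions. -/
abbrev TapeSymbol : Type := TM2to1.Γ' PartrecToTM2.K' fun _ => PartrecToTM2.Γ'

/-- The initial tape of the machine for a partial recursive function. -/
def numeralTape (n : ℕ) : List TapeSymbol :=
  TM2to1.trInit PartrecToTM2.K'.main (PartrecToTM2.trList [n])

theorem exists_finite_TM0_of_partrec {f : ℕ →. ℕ} (hf : Nat.Partrec f) :
    ∃ (Q : Type) (_ : Fintype Q) (_ : Inhabited Q) (N : TM0.Machine TapeSymbol Q),
      ∀ n, (TM0.eval N (numeralTape n)).Dom ↔ (f n).Dom := by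
  obtain ⟨c, hc⟩ := ToPartrec.Code.exists_code (Nat.Partrec'.part_iff₁.2 (Partrec.nat_iff.2 hf))
  -- Machines start in the `default` state, so the instance is chosen to be the entry point of the
  -- program for `c`.
  obtain ⟨Q, hQ, iQ, N, hN⟩ := @exists_finite_TM0_of_TM2 _ _ _ _ _
    ⟨PartrecToTM2.trNormal c .halt⟩ _ _ _ _ (PartrecToTM2.tr_supports c .halt) .main
  refine ⟨Q, hQ, iQ, N, fun n => (hN _).trans ?_⟩
  have h := PartrecToTM2.tr_eval c [n]
  rw [show c.eval [n] = _ from hc ⟨[n], rfl⟩] at h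
  let _ : Inhabited PartrecToTM2.Λ' := ⟨PartrecToTM2.trNormal c .halt⟩
  have hinit : PartrecToTM2.init c [n] = TM2.init .main (PartrecToTM2.trList [n]) :=
    congrArg (TM2.Cfg.mk _ _) (funext fun k => by cases k <;> rfl)
  rw [hinit] at h
  exact iff_of_eq (congrArg Part.Dom h)

/-! ### Computability of the initial tape -/

theorem primrec_natBits : Primrec Nat.bits := by
  -- Course-of-values recursion: `l` lists the values below `n`, so `l.length` is `n` and the entry
  -- at `n.div2` is the tail of `n.bits`.
  have hg : Primrec₂ fun (_ : Unit) (l : List (List Bool)) =>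
      if l.length = 0 then some [] else
        (l[l.length.div2]?).map fun b => l.length.bodd :: b := by
    have hl : Primrec fun p : Unit × List (List Bool) => p.2.length :=
      Primrec.list_length.comp Primrec.snd
    refine Primrec.ite (Primrec.eq.comp hl (Primrec.const 0)) (Primrec.const _) ?_
    exact Primrec.option_map (Primrec.list_getElem?.comp Primrec.snd (Primrec.nat_div2.comp hl))
      (Primrec.list_cons.comp (Primrec.nat_bodd.comp (hl.comp Primrec.fst)) Primrec.snd)
  refine (Primrec.nat_strong_rec (fun (_ : Unit) n => n.bits) hg fun _ n => ?_).comp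
    (Primrec.const ()) Primrec.id
  rcases Nat.eq_zero_or_pos n with rfl | hn
  · simp
  · have h : n.div2 < n := Nat.binaryRec_decreasing hn.ne'
    have hb := Nat.bits_append_bit n.div2 n.bodd fun h0 => by
      rw [← Nat.bit_bodd_div2 n, h0] at hn
      cases hb : n.bodd <;> simp_all
    rw [Nat.bit_bodd_div2] at hb
    simp [hn.ne', h, hb]

/-- The tape symbol for a stack symbol on the main stack. -/
def mainSymbol (bottom : Bool) (a : PartrecToTM2.Γ') : TapeSymbol :=
  (bottom, Function.update (fun _ => none) .main (some a))

theorem trNat_eq_map_bits (n : ℕ) :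
    PartrecToTM2.trNat n = n.bits.map fun b => cond b .bit1 .bit0 := by
  induction n using Nat.binaryRec' with
  | zero => simp
  | bit b n h ih =>
    rw [Nat.bits_append_bit n b h, List.map_cons, ← ih, PartrecToTM2.trNat, PartrecToTM2.trNat,
      ← Num.ofNat'_eq, ← Num.ofNat'_eq, Num.ofNat'_bit]
    rcases hn : Num.ofNat' n with _ | m
    · rw [h ?_]
      · rfl
      · have := Num.ofNat'_eq n
        rw [hn] at this
        simpa using (congrArg (fun m : Num => (m : ℕ)) this).symm
    · cases b <;> rfl

/-- `trInit` reverses the stack, so the terminator `cons` comes first, with the bottom mark, and the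
bits follow in reverse order. In this form the tape is visibly computable. -/
theorem numeralTape_eq (n : ℕ) : numeralTape n = mainSymbol true .cons ::
    n.bits.reverse.map fun b => mainSymbol false (cond b .bit1 .bit0) := by
  rw [numeralTape, TM2to1.trInit, PartrecToTM2.trList, PartrecToTM2.trList, trNat_eq_map_bits,
    List.reverse_append, ← List.map_reverse]
  exact congrArg _ (List.map_map ..)

end HyperMC

theorem mainTheorem7 {α : Type*} [Primcodable α] (p : α → Prop) (hp : REPred p) :
    p ≤₀ HyperMC.UModelChecking := by
  open HyperMC in
  -- `Partrec` unfolds to `Nat.Partrec` on codes, so the machine takes `Encodable.encode a` as its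
  -- input.
  obtain ⟨Q, _, _, M, hM⟩ := exists_finite_TM0_of_partrec hp
  let e := Fintype.equivFin (Letter TapeSymbol Q)
  have h (a : α) : p a ↔ Spiral (.inl false) (.inr (default, none)) (.inl true) (StepRel M)
      (IsHalting M) (inputLetters (numeralTape (Encodable.encode a))) := by
    rw [spiral_iff_eval_dom, hM]
    simp [Part.assert]
  rw [funext fun a => propext (h a)]
  refine spiral_manyOneReducible e _ _ (by simp) (by simp) (fun a => by
    simp only [inputLetters, List.mem_cons, List.mem_map, reduceCtorEq, false_or, and_false,
      exists_false, not_false_eq_true]) ?_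
  simp only [numeralTape_eq, inputLetters, List.headI_cons, List.tail_cons, List.map_cons,
    List.map_map, Function.comp_def]
  -- The letter that carries the head is constant, since all numeral tapes begin with the same
  -- symbol.
  exact (Primrec.list_cons.comp (Primrec.const _) (Primrec.list_map
    (Primrec.list_reverse.comp (primrec_natBits.comp Primrec.encode))
    ((Primrec.dom_finite _).comp₂ Primrec₂.right))).to_comp
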